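/- Let $n \ge 1$, let $x_1 < x_2 < \cdots < x_n$ and $y_1 < y_2 < \cdots < y_n$ be real numbers, and let $A = [e^{x_i y_j}]_{i,j=1,\ldots,n}$. Put $V(\mathbf{x}) = \prod_{1 \le i < j \le n} (x_j - x_i)$, $V(\mathbf{y}) = \prod_{1 \le i < j \le n} (y_j - y_i)$ and $c_n = \prod_{i=1}^{n-1} i!$ (empty products being $1$). Then $$\det(A) \ge \frac{1}{c_n} V(\mathbf{x}) V(\mathbf{y})\, e^{(x_1 + \cdots + x_n)(y_1 + \cdots + y_n)/n}$$ and $$\det(A) \le \frac{1}{c_n} V(\mathbf{x}) V(\mathbf{y})\, e^{x_1 y_1 + \cdots + x_n y_n}.$$ -/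

import Mathlib

/-- The exponential matrix `[e^{x_i y_j}]`. -/
noncomputable def expMatrix {n : ℕ} (x y : Fin n → ℝ) : Matrix (Fin n) (Fin n) ℝ :=
  Matrix.of fun i j => Real.exp (x i * y j)

/-- The Vandermonde polynomial `V(x) = ∏_{i < j} (x_j - x_i)`. -/
def vandermondePoly {n : ℕ} (x : Fin n → ℝ) : ℝ :=
  ∏ i : Fin n, ∏ j ∈ Finset.Ioi i, (x j - x i)

/-- The constant `c_n = ∏_{i=1}^{n-1} i!`. -/
def superfactConst (n : ℕ) : ℕ :=
  ∏ i ∈ Finset.Icc 1 (n - 1), i.factorial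

/-! Induction on the size. Taking `exp (x i * y 0)` out of each row makes the first column one; row
differences and the fundamental theorem of calculus then give an integral of the smaller
determinant, with exponents `z j = y j.succ - y 0`, over the interlacing box (`det_expMatrix_succ`).
The same argument for powers shows that `vandermondePoly x` is `n!` times the integral of
`vandermondePoly t`, a nonnegative weight on the box. Upper bound: `t i ≤ x i.succ` in the exponent.
Lower bound: Jensen for `exp` with this weight, where the mean of `∑ t i` comes from a Vandermonde
determinant with its last exponent raised. Points of the closed box may have equal coordinates, so
the induction assumes only `Monotone`. -/

open MeasureTheory Matrix

/-! ### Determinants as integrals over boxes -/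

/-- The determinant of a function matrix integrates over a box entry by entry. -/
theorem setIntegral_Icc_det {n : ℕ} (f : Fin n → ℝ → ℝ) (hf : ∀ j, Continuous (f j))
    (a b : Fin n → ℝ) :
    ∫ t in Set.Icc a b, (of fun i j => f j (t i)).det =
      (of fun i j => ∫ s in Set.Icc (a i) (b i), f j s).det := by
  have hμ : (volume : Measure (Fin n → ℝ)).restrict (Set.Icc a b) =
      Measure.pi fun i => volume.restrict (Set.Icc (a i) (b i)) := by
    rw [← Set.pi_univ_Icc, volume_pi, Measure.restrict_pi_pi]
  -- After transposing, the `i`-th Leibniz factor depends on `t i` alone, so Fubini applies to each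
  -- term.
  simp_rw [← det_transpose (of fun i j => ∫ s in Set.Icc (a i) (b i), f j s),
    ← fun t : Fin n → ℝ => det_transpose (of fun i j => f j (t i)), det_apply', transpose_apply,
    of_apply]
  rw [integral_finsetSum]
  · refine Finset.sum_congr rfl fun σ _ => ?_
    rw [integral_const_mul, hμ, integral_fintype_prod_eq_prod]
  · intro σ _
    refine ContinuousOn.integrableOn_compact isCompact_Icc (Continuous.continuousOn ?_)
    exact continuous_const.mul (continuous_finsetProd _ fun i _ =>
      (hf _).comp (continuous_apply i))

/-- If the first column is constantly one, the determinant is that of successive row differences. -/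
theorem det_eq_det_sub_of_col_zero_eq_one {R : Type*} [CommRing R] {n : ℕ}
    (A : Matrix (Fin (n + 1)) (Fin (n + 1)) R) (hA : ∀ i, A i 0 = 1) :
    A.det = (of fun i j : Fin n => A i.succ j.succ - A i.castSucc j.succ).det := by
  let B : Matrix (Fin (n + 1)) (Fin (n + 1)) R :=
    of (Fin.cons (A 0) fun i j => A i.succ j - A i.castSucc j)
  rw [det_eq_of_forall_row_eq_smul_add_pred (B := B) (fun _ => 1) (fun j => by simp [B])
    (fun i j => by simp [B]), det_succ_column_zero, Fin.sum_univ_succ, Finset.sum_eq_zero]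
  · simp [B, hA]
    rfl
  · intro i _
    simp [B, hA]

/-- A determinant with constant first column as an integral over the interlacing box. -/
theorem det_eq_setIntegral_det_deriv {n : ℕ} (F : Fin (n + 1) → ℝ → ℝ) (f : Fin n → ℝ → ℝ)
    (hF0 : ∀ s, F 0 s = 1) (hF : ∀ j s, HasDerivAt (F j.succ) (f j s) s)
    (hf : ∀ j, Continuous (f j)) {x : Fin (n + 1) → ℝ} (hx : Monotone x) :
    (of fun i j => F j (x i)).det =
      ∫ t in Set.Icc (fun i : Fin n => x i.castSucc) (fun i => x i.succ),
        (of fun i j => f j (t i)).det := by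
  rw [setIntegral_Icc_det f hf, det_eq_det_sub_of_col_zero_eq_one _ fun i => by simp [hF0]]
  congr 1
  ext i j
  simp only [of_apply]
  rw [integral_Icc_eq_integral_Ioc,
    ← intervalIntegral.integral_of_le (hx (Fin.castSucc_le_succ i)),
    intervalIntegral.integral_eq_sub_of_hasDerivAt (fun s _ => hF j s)
      ((hf j).intervalIntegrable _ _)]

/-! ### Vandermonde determinants and their moments -/

theorem vandermondePoly_eq_det {n : ℕ} (x : Fin n → ℝ) :
    vandermondePoly x = (vandermonde x).det :=
  (det_vandermonde x).symm

theorem continuous_vandermondePoly {n : ℕ} :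
    Continuous (vandermondePoly : (Fin n → ℝ) → ℝ) := by
  unfold vandermondePoly
  fun_prop

theorem vandermondePoly_nonneg {n : ℕ} {x : Fin n → ℝ} (hx : Monotone x) :
    0 ≤ vandermondePoly x :=
  Finset.prod_nonneg fun _ _ => Finset.prod_nonneg fun _ hj =>
    sub_nonneg.2 (hx (Finset.mem_Ioi.1 hj).le)

theorem vandermondePoly_succ {n : ℕ} (y : Fin (n + 1) → ℝ) :
    vandermondePoly y =
      (∏ j : Fin n, (y j.succ - y 0)) * vandermondePoly fun j : Fin n => y j.succ - y 0 := by
  simp [vandermondePoly, Fin.prod_univ_succ, Fin.Ioi_zero_eq_map, Fin.prod_Ioi_succ]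

/-- Raising the last exponent of the Vandermonde matrix by one multiplies its determinant by the
sum of the nodes. -/
theorem det_pow_skip {R : Type*} [CommRing R] [Nontrivial R] {n : ℕ} (v : Fin (n + 1) → R) :
    (of fun i j : Fin (n + 1) => v i ^ (if j = Fin.last n then n + 1 else (j : ℕ))).det =
      (∑ i, v i) * (vandermonde v).det := by
  let P : Polynomial R := ∏ i, (Polynomial.X - Polynomial.C (v i))
  have hdeg : P.natDegree = n + 1 := by simp [P]
  have hmonic : P.Monic := Polynomial.monic_prod_of_monic _ _ fun i _ => Polynomial.monic_X_sub_C _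
  have hcoeff : P.coeff n = -∑ i, v i := by
    have h := Polynomial.prod_X_sub_C_coeff_card_pred Finset.univ v (by simp)
    simpa using h
  have hroot : ∀ i, v i ^ (n + 1) = ∑ k : Fin (n + 1), (-P.coeff k) * v i ^ (k : ℕ) := by
    intro i
    have h0 : P.eval (v i) = 0 := by
      simp only [P, Polynomial.eval_prod]
      exact Finset.prod_eq_zero (Finset.mem_univ i) (by simp)
    rw [Polynomial.eval_eq_sum_range, hdeg, Finset.sum_range_succ] at h0
    have h1 : P.coeff (n + 1) = 1 := by rw [← hdeg]; exact hmonic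
    rw [h1, one_mul] at h0
    rw [Fin.sum_univ_eq_sum_range (fun k => (-P.coeff k) * v i ^ k) (n + 1)]
    simp only [neg_mul, Finset.sum_neg_distrib]
    linear_combination h0
  -- By `hroot` the raised column combines the columns of lower powers; only the coefficient of the
  -- last one, the sum of the nodes, survives.
  have h := det_updateCol_sum (vandermonde v) (Fin.last n) fun k => -P.coeff k
  simp only [Fin.val_last, hcoeff, neg_neg, smul_eq_mul] at h
  rw [← h]
  congr 1
  ext i j
  rw [updateCol_apply, of_apply]
  split_ifs with hj
  · simp [hroot]
  · simp

theorem vandermondePoly_eq_factorial_mul_setIntegral {n : ℕ} {x : Fin (n + 1) → ℝ}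
    (hx : Monotone x) :
    vandermondePoly x = n.factorial *
      ∫ t in Set.Icc (fun i : Fin n => x i.castSucc) (fun i => x i.succ), vandermondePoly t := by
  have h := det_eq_setIntegral_det_deriv (fun j s => s ^ (j : ℕ))
    (fun (j : Fin n) s => ((j : ℕ) + 1 : ℝ) * s ^ (j : ℕ)) (by simp)
    (fun j s => by simpa using hasDerivAt_pow ((j : ℕ) + 1) s) (fun j => by fun_prop) hx
  have hfac : (n.factorial : ℝ) = ∏ j : Fin n, ((j : ℕ) + 1 : ℝ) := by
    rw [Fin.prod_univ_eq_prod_range (fun j => (j + 1 : ℝ)) n,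
      ← Finset.prod_range_add_one_eq_factorial]
    push_cast
    rfl
  rw [vandermondePoly_eq_det, ← integral_const_mul, hfac]
  simp_rw [vandermondePoly_eq_det, ← det_mul_row]
  exact h

/-- Gives the mean of `∑ t i` for the Vandermonde weight. Differentiating the exponents `1, …, n, n
+ 2` produces the constant `n! * (n + 2)`. -/
theorem sum_mul_vandermondePoly_eq_setIntegral {n : ℕ} {x : Fin (n + 2) → ℝ}
    (hx : Monotone x) :
    (∑ i, x i) * vandermondePoly x = (n.factorial * (n + 2)) *
      ∫ t in Set.Icc (fun i : Fin (n + 1) => x i.castSucc) (fun i => x i.succ),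
        (∑ i, t i) * vandermondePoly t := by
  have h := det_eq_setIntegral_det_deriv
    (fun (j : Fin (n + 2)) s => s ^ (if j = Fin.last (n + 1) then n + 2 else (j : ℕ)))
    (fun (j : Fin (n + 1)) s => ((if j = Fin.last n then n + 1 else (j : ℕ) : ℕ) + 1 : ℝ) *
      s ^ (if j = Fin.last n then n + 1 else (j : ℕ))) (by simp [Fin.ext_iff])
    (fun j s => by
      have h := hasDerivAt_pow ((if j = Fin.last n then n + 1 else (j : ℕ)) + 1) s
      have e : (if j.succ = Fin.last (n + 1) then n + 2 else (j.succ : ℕ)) =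
          (if j = Fin.last n then n + 1 else (j : ℕ)) + 1 := by
        simp only [← Fin.succ_last, Fin.succ_inj, Fin.val_succ]
        split_ifs <;> rfl
      rw [e]
      simpa using h) (fun j => by fun_prop) hx
  have hfac : (n.factorial * (n + 2) : ℝ) =
      ∏ j : Fin (n + 1), ((if j = Fin.last n then n + 1 else (j : ℕ) : ℕ) + 1 : ℝ) := by
    rw [Fin.prod_univ_castSucc]
    simp only [Fin.castSucc_ne_last, if_true, if_false, Fin.val_castSucc]
    rw [Fin.prod_univ_eq_prod_range (fun j => (j + 1 : ℝ)) n,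
      ← Finset.prod_range_add_one_eq_factorial]
    push_cast
    ring
  rw [vandermondePoly_eq_det, ← det_pow_skip, ← integral_const_mul, hfac]
  simp_rw [vandermondePoly_eq_det, ← det_pow_skip, ← det_mul_row]
  exact h

/-! ### Recursion for the exponential determinant -/

theorem det_expMatrix_succ {n : ℕ} {x : Fin (n + 1) → ℝ} (hx : Monotone x)
    (y : Fin (n + 1) → ℝ) :
    (expMatrix x y).det = Real.exp ((∑ i, x i) * y 0) * ((∏ j : Fin n, (y j.succ - y 0)) *
      ∫ t in Set.Icc (fun i : Fin n => x i.castSucc) (fun i => x i.succ),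
        (expMatrix t fun j => y j.succ - y 0).det) := by
  have h := det_eq_setIntegral_det_deriv (fun j s => Real.exp (s * (y j - y 0)))
    (fun (j : Fin n) s => (y j.succ - y 0) * Real.exp (s * (y j.succ - y 0))) (by simp)
    (fun j s => by
      simpa [mul_comm] using ((hasDerivAt_id s).mul_const (y j.succ - y 0)).exp)
    (fun j => by fun_prop) hx
  rw [← integral_const_mul, Finset.sum_mul, Real.exp_sum]
  simp_rw [expMatrix, ← det_mul_row]
  simp only [of_apply]
  rw [← h, ← det_mul_column]
  congr 1
  ext i j
  simp only [of_apply, ← Real.exp_add]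
  congr 1
  ring

theorem continuous_det_expMatrix {n : ℕ} (y : Fin n → ℝ) :
    Continuous fun x : Fin n → ℝ => (expMatrix x y).det := by
  unfold expMatrix
  refine Continuous.matrix_det (continuous_matrix fun i j => ?_)
  simp only [of_apply]
  fun_prop

theorem superfactConst_succ_succ (n : ℕ) :
    superfactConst (n + 2) = superfactConst (n + 1) * (n + 1).factorial := by
  simp only [superfactConst, Nat.add_sub_cancel, show n + 2 - 1 = n + 1 from rfl]
  rw [Finset.prod_Icc_succ_top (by omega)]

theorem superfactConst_pos (n : ℕ) : 0 < superfactConst n :=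
  Finset.prod_pos fun _ _ => Nat.factorial_pos _

/-- A point of the interlacing box of a monotone tuple is monotone. -/
theorem monotone_of_mem_interlacing {n : ℕ} {x : Fin (n + 1) → ℝ} (hx : Monotone x)
    {t : Fin n → ℝ} (ht : t ∈ Set.Icc (fun i : Fin n => x i.castSucc) (fun i => x i.succ)) :
    Monotone t := by
  intro i j hij
  rcases hij.eq_or_lt with rfl | h
  · exact le_rfl
  · exact (ht.2 i).trans ((hx (Fin.succ_le_castSucc_iff.2 h)).trans (ht.1 j))

/-! ### The two bounds -/

theorem det_expMatrix_le {n : ℕ} {x y : Fin (n + 1) → ℝ} (hx : Monotone x) (hy : Monotone y) :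
    (expMatrix x y).det ≤ 1 / (superfactConst (n + 1) : ℝ) * vandermondePoly x *
      vandermondePoly y * Real.exp (∑ i, x i * y i) := by
  induction n with
  | zero => simp [expMatrix, superfactConst, vandermondePoly]
  | succ n ih =>
    set z : Fin (n + 1) → ℝ := fun j => y j.succ - y 0 with hz
    have hz0 : ∀ j, 0 ≤ z j := fun j => sub_nonneg.2 (hy (Fin.zero_le _))
    have hzm : Monotone z := fun i j hij => sub_le_sub_right (hy (Fin.succ_le_succ_iff.2 hij)) _
    have hc : (0 : ℝ) < superfactConst (n + 1) := by exact_mod_cast superfactConst_pos _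
    have hint : ∫ t in Set.Icc (fun i : Fin (n + 1) => x i.castSucc) (fun i => x i.succ),
        (expMatrix t z).det ≤
        ∫ t in Set.Icc (fun i : Fin (n + 1) => x i.castSucc) (fun i => x i.succ),
          (1 / (superfactConst (n + 1) : ℝ) * vandermondePoly z *
            Real.exp (∑ i, x i.succ * z i)) * vandermondePoly t := by
      refine setIntegral_mono_on
        ((continuous_det_expMatrix z).continuousOn.integrableOn_compact isCompact_Icc)
        ((continuous_const.mul continuous_vandermondePoly).continuousOn.integrableOn_compact
          isCompact_Icc) measurableSet_Icc fun t ht => ?_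
      have htm := monotone_of_mem_interlacing hx ht
      have hV := vandermondePoly_nonneg htm
      have hVz := vandermondePoly_nonneg hzm
      have hexp : Real.exp (∑ i, t i * z i) ≤ Real.exp (∑ i, x i.succ * z i) :=
        Real.exp_le_exp.2 (Finset.sum_le_sum fun i _ =>
          mul_le_mul_of_nonneg_right (ht.2 i) (hz0 i))
      calc (expMatrix t z).det ≤ 1 / (superfactConst (n + 1) : ℝ) * vandermondePoly t *
            vandermondePoly z * Real.exp (∑ i, t i * z i) := ih htm hzm
        _ ≤ 1 / (superfactConst (n + 1) : ℝ) * vandermondePoly t *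
            vandermondePoly z * Real.exp (∑ i, x i.succ * z i) := by gcongr
        _ = _ := by ring
    rw [integral_const_mul] at hint
    have hP : 0 ≤ ∏ j, z j := Finset.prod_nonneg fun j _ => hz0 j
    have hsum : ∑ i, x i * y i = (∑ i, x i) * y 0 + ∑ i : Fin (n + 1), x i.succ * z i := by
      rw [Fin.sum_univ_succ, Fin.sum_univ_succ x, add_mul, Finset.sum_mul, add_assoc (x 0 * y 0),
        ← Finset.sum_add_distrib]
      congr 1
      exact Finset.sum_congr rfl fun i _ => by simp only [hz]; ring
    have hfac : ((n + 1).factorial : ℝ) ≠ 0 := by exact_mod_cast Nat.factorial_ne_zero _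
    rw [det_expMatrix_succ hx y, vandermondePoly_succ y, hsum, Real.exp_add,
      vandermondePoly_eq_factorial_mul_setIntegral hx, superfactConst_succ_succ]
    refine (mul_le_mul_of_nonneg_left (mul_le_mul_of_nonneg_left hint hP)
      (Real.exp_pos _).le).trans_eq ?_
    push_cast
    simp only [← hz]
    field_simp

theorem le_det_expMatrix {n : ℕ} {x y : Fin (n + 1) → ℝ} (hx : Monotone x) (hy : Monotone y) :
    1 / (superfactConst (n + 1) : ℝ) * vandermondePoly x * vandermondePoly y *
      Real.exp ((∑ i, x i) * (∑ j, y j) / ((n + 1 : ℕ) : ℝ)) ≤ (expMatrix x y).det := by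
  induction n with
  | zero => simp [expMatrix, superfactConst, vandermondePoly]
  | succ n ih =>
    set z : Fin (n + 1) → ℝ := fun j => y j.succ - y 0 with hz
    have hz0 : ∀ j, 0 ≤ z j := fun j => sub_nonneg.2 (hy (Fin.zero_le _))
    have hzm : Monotone z := fun i j hij => sub_le_sub_right (hy (Fin.succ_le_succ_iff.2 hij)) _
    have hc : (0 : ℝ) < superfactConst (n + 1) := by exact_mod_cast superfactConst_pos _
    -- the mean of the exponent with respect to the density `vandermondePoly t` on the box
    set M : ℝ := (∑ i, x i) * (∑ j, z j) / (n + 2) with hM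
    set K : ℝ := 1 / (superfactConst (n + 1) : ℝ) * vandermondePoly z * Real.exp M with hK
    have hcont₁ : Continuous fun t : Fin (n + 1) → ℝ => K * (1 - M) * vandermondePoly t :=
      continuous_const.mul continuous_vandermondePoly
    have hcont₂ : Continuous fun t : Fin (n + 1) → ℝ =>
        K * ((∑ j, z j) / (n + 1)) * ((∑ i, t i) * vandermondePoly t) :=
      continuous_const.mul
        ((continuous_finsetSum _ fun i _ => continuous_apply i).mul continuous_vandermondePoly)
    have hint : ∫ t in Set.Icc (fun i : Fin (n + 1) => x i.castSucc) (fun i => x i.succ),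
          (K * (1 - M) * vandermondePoly t +
            K * ((∑ j, z j) / (n + 1)) * ((∑ i, t i) * vandermondePoly t)) ≤
        ∫ t in Set.Icc (fun i : Fin (n + 1) => x i.castSucc) (fun i => x i.succ),
          (expMatrix t z).det := by
      refine setIntegral_mono_on
        ((hcont₁.add hcont₂).continuousOn.integrableOn_compact isCompact_Icc)
        ((continuous_det_expMatrix z).continuousOn.integrableOn_compact isCompact_Icc)
        measurableSet_Icc fun t ht => ?_
      have htm := monotone_of_mem_interlacing hx ht
      have hV := vandermondePoly_nonneg htm
      have hVz := vandermondePoly_nonneg hzm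
      set L : ℝ := (∑ i, t i) * (∑ j, z j) / ((n + 1 : ℕ) : ℝ) with hL
      -- Jensen by hand: the tangent line of `exp` at `M` lies below `exp`, and no division by the
      -- total weight is needed.
      have hexp : Real.exp M * (1 + L - M) ≤ Real.exp L := by
        have h := Real.add_one_le_exp (L - M)
        calc Real.exp M * (1 + L - M) ≤ Real.exp M * Real.exp (L - M) := by
              gcongr
              linarith
          _ = Real.exp L := by rw [← Real.exp_add]; congr 1; ring
      calc _ = 1 / (superfactConst (n + 1) : ℝ) * vandermondePoly t * vandermondePoly z *
              (Real.exp M * (1 + L - M)) := by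
            simp only [hK, hL]
            push_cast
            ring
        _ ≤ 1 / (superfactConst (n + 1) : ℝ) * vandermondePoly t * vandermondePoly z *
              Real.exp L := by gcongr
        _ ≤ _ := ih htm hzm
    rw [integral_add (hcont₁.continuousOn.integrableOn_compact isCompact_Icc)
      (hcont₂.continuousOn.integrableOn_compact isCompact_Icc), integral_const_mul,
      integral_const_mul] at hint
    have hP : 0 ≤ ∏ j, z j := Finset.prod_nonneg fun j _ => hz0 j
    have hsum : (∑ i, x i) * (∑ j, y j) / ((n + 1 + 1 : ℕ) : ℝ) = (∑ i, x i) * y 0 + M := by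
      have : ∑ j, z j = (∑ j, y j) - (n + 2) * y 0 := by
        rw [Fin.sum_univ_succ y]
        simp only [hz, Finset.sum_sub_distrib, Finset.sum_const, Finset.card_univ,
          Fintype.card_fin, nsmul_eq_mul]
        push_cast
        ring
      rw [hM, this]
      push_cast
      field_simp
      ring
    have hfac : (n.factorial : ℝ) ≠ 0 := by exact_mod_cast Nat.factorial_ne_zero _
    have hI := vandermondePoly_eq_factorial_mul_setIntegral hx
    have hJ := sum_mul_vandermondePoly_eq_setIntegral hx
    rw [det_expMatrix_succ hx y, vandermondePoly_succ y, hsum, Real.exp_add,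
      superfactConst_succ_succ]
    refine le_trans (le_of_eq ?_) (mul_le_mul_of_nonneg_left (mul_le_mul_of_nonneg_left hint hP)
      (Real.exp_pos _).le)
    rw [Nat.factorial_succ] at hI ⊢
    push_cast at hI ⊢
    set I := ∫ t in Set.Icc (fun i : Fin (n + 1) => x i.castSucc) (fun i => x i.succ),
      vandermondePoly t
    set J := ∫ t in Set.Icc (fun i : Fin (n + 1) => x i.castSucc) (fun i => x i.succ),
      (∑ i, t i) * vandermondePoly t
    -- `M` is the weighted mean of the exponent, so the linear term of the tangent line integrates
    -- to zero.
    have hMI : M * I = (∑ j, z j) / (n + 1) * J := by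
      rw [hI] at hJ
      have hIJ : (∑ i, x i) * (n + 1) * I = (n + 2) * J :=
        mul_left_cancel₀ hfac (by linear_combination hJ)
      rw [hM]
      field_simp
      linear_combination (∑ j, z j) * hIJ
    have hKI : K * (1 - M) * I + K * ((∑ j, z j) / (n + 1)) * J = K * I := by
      linear_combination -K * hMI
    rw [hKI, hI, hK]
    simp only [← hz]
    field_simp

theorem theorem1 (n : ℕ) (hn : 1 ≤ n) (x y : Fin n → ℝ)
    (hx : StrictMono x) (hy : StrictMono y) :
    1 / (superfactConst n : ℝ) * vandermondePoly x * vandermondePoly y *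
        Real.exp ((∑ i, x i) * (∑ j, y j) / (n : ℝ)) ≤ (expMatrix x y).det ∧
    (expMatrix x y).det ≤
      1 / (superfactConst n : ℝ) * vandermondePoly x * vandermondePoly y *
        Real.exp (∑ i, x i * y i) := by
  obtain ⟨m, rfl⟩ := Nat.exists_eq_add_of_le' hn
  exact ⟨le_det_expMatrix hx.monotone hy.monotone, det_expMatrix_le hx.monotone hy.monotone⟩
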